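/- Let $(R,\mathfrak m,k)$ be a complete Cohen--Macaulay (in particular Noetherian) local ring of dimension $d$ with a coefficient field $k\subseteq R$, and let $f_1,\dots,f_c,x_1,\dots,x_{d-c}$ be a system of parameters of $R$. Let $A=k[[T_1,\dots,T_{d-c}]]$ be the power series ring, with maximal ideal $\mathfrak m_A$, and let $A\to R$ be the $k$-algebra homomorphism with $T_i\mapsto x_i$. For a sequence $\underline g=(g_1,\dots,g_c)$ in $R$, regard $R/(\underline g)$ as an $A$-algebra via $A\to R\to R/(\underline g)$. If an $A$-algebra $B$ is finite and free as an $A$-module, then for a basis $e_1,\dots,e_r$ of $B$ over $A$ the element $\det(\mathrm{Tr}_{B/A}(e_ie_j))_{i,j}\in A$ is called a discriminant of $B$ over $A$, written $\mathrm{Disc}_A(B)$; it is independent of the basis up to multiplication by (the square of) a unit of $A$. Then $R/(\underline f)$ is a finite free $A$-module, and there exists an integer $C\ge 0$ such that for all $n\ge 1$ and all $\underline\epsilon=(\epsilon_1,\dots,\epsilon_c)$ with every $\epsilon_i\in\mathfrak m^{Cn}$: the sequence $f_1+\epsilon_1,\dots,f_c+\epsilon_c,x_1,\dots,x_{d-c}$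 is a system of parameters of $R$, $R/(\underline f+\underline\epsilon)$ is a finite free $A$-module, and $$\mathrm{Disc}_A(R/(\underline f))\equiv\mathrm{Disc}_A(R/(\underline f+\underline\epsilon)) \pmod{\mathfrak m_A^{\,n}},$$ in the sense that every discriminant of $R/(\underline f)$ (for any basis) is congruent modulo $\mathfrak m_A^{\,n}$ to a discriminant of $R/(\underline f+\underline\epsilon)$ for a suitable basis, and vice versa. -/

import Mathlib

open IsLocalRing

/-- A Noetherian local ring is Cohen-Macaulay if its depth equals its dimension, that is, if there
is a regular sequence in the maximal ideal whose length is the Krull dimension. -/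
class IsCohenMacaulayLocal (R : Type*) [CommRing R] [IsLocalRing R] : Prop where
  noetherian : IsNoetherianRing R
  exists_regular : ∃ rs : List R, (∀ r ∈ rs, r ∈ maximalIdeal R) ∧
    RingTheory.Sequence.IsRegular R rs ∧ (rs.length : WithBot ℕ∞) = ringKrullDim R

/-- A field `k` inside a local ring `R` is a coefficient field if it maps isomorphically onto the
residue field of `R`. -/
def IsCoefficientField (k R : Type*) [Field k] [CommRing R] [IsLocalRing R] [Algebra k R] : Prop :=
  Function.Bijective fun a : k => residue R (algebraMap k R a)

/-- A system of parameters of a local ring: a sequence of length `dim R` generating an ideal that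
is primary to the maximal ideal. -/
structure IsSystemOfParameters {R : Type*} [CommRing R] [IsLocalRing R] {d : ℕ}
    (y : Fin d → R) : Prop where
  dim_eq : ringKrullDim R = d
  radical_eq : (Ideal.span (Set.range y)).radical = maximalIdeal R

lemma IsSystemOfParameters.mem {R : Type*} [CommRing R] [IsLocalRing R] {d : ℕ}
    {y : Fin d → R} (h : IsSystemOfParameters y) (i : Fin d) : y i ∈ maximalIdeal R :=
  h.radical_eq ▸ Ideal.le_radical (Ideal.subset_span ⟨i, rfl⟩)

lemma IsSystemOfParameters.mem_right {R : Type*} [CommRing R] [IsLocalRing R] {c s : ℕ}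
    {f : Fin c → R} {x : Fin s → R} (h : IsSystemOfParameters (Fin.append f x)) (i : Fin s) :
    x i ∈ maximalIdeal R := by
  simpa using h.mem (Fin.natAdd c i)

/-- Substitution of elements `x i` of the maximal ideal of a complete local `k`-algebra `R` into
power series: the (unique) `k`-algebra map `k[[T₁, …, Tₛ]] → R` with `Tᵢ ↦ x i`. It is continuous
for the product topology on power series (with `k` discrete) and the adic topology on `R`. -/
noncomputable def powerSeriesEval (k : Type*) {R : Type*} [Field k] [CommRing R] [IsLocalRing R]
    [IsAdicComplete (maximalIdeal R) R] [Algebra k R] {s : ℕ} (x : Fin s → R)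
    (hx : ∀ i, x i ∈ maximalIdeal R) : MvPowerSeries (Fin s) k →ₐ[k] R :=
  letI : UniformSpace k := ⊥
  haveI : DiscreteTopology k := ⟨rfl⟩
  haveI : DiscreteUniformity k := ⟨rfl⟩
  haveI : IsUniformAddGroup k := inferInstance
  letI : WithIdeal R := ⟨maximalIdeal R⟩
  have hc : CompleteSpace R ∧ T2Space R :=
    (IsAdic.isAdicComplete_iff (I := maximalIdeal R) rfl).mp inferInstance
  haveI := hc.1
  haveI := hc.2
  haveI : ContinuousSMul k R := DiscreteTopology.instContinuousSMul k R
  MvPowerSeries.aeval (R := k) (S := R) (a := x)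
    { hpow := fun i => WithIdeal.isTopologicallyNilpotent_of_mem (hx i)
      tendsto_zero := by simp [Filter.cofinite_eq_bot] }

lemma powerSeriesEval_X (k : Type*) {R : Type*} [Field k] [CommRing R] [IsLocalRing R]
    [IsAdicComplete (maximalIdeal R) R] [Algebra k R] {s : ℕ} (x : Fin s → R)
    (hx : ∀ i, x i ∈ maximalIdeal R) (i : Fin s) :
    powerSeriesEval k x hx (MvPowerSeries.X i) = x i := by
  let : UniformSpace k := ⊥
  have : DiscreteTopology k := ⟨rfl⟩
  have : DiscreteUniformity k := ⟨rfl⟩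
  let : WithIdeal R := ⟨maximalIdeal R⟩
  have hc : CompleteSpace R ∧ T2Space R :=
    (IsAdic.isAdicComplete_iff (I := maximalIdeal R) rfl).mp inferInstance
  have := hc.1
  have := hc.2
  have : ContinuousSMul k R := DiscreteTopology.instContinuousSMul k R
  unfold powerSeriesEval
  rw [MvPowerSeries.coe_aeval, MvPowerSeries.eval₂_X]

/-- The structure map `k[[T₁, …, Tₛ]] → R/(g)`, `Tᵢ ↦ x i`, which on constants is the coefficient
field of `R/(g)` induced by `k → R`. -/
noncomputable def paramMap (k : Type*) {R : Type*} [Field k] [CommRing R] [IsLocalRing R]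
    [IsAdicComplete (maximalIdeal R) R] [Algebra k R] {c s : ℕ} (g : Fin c → R) (x : Fin s → R)
    (hx : ∀ i, x i ∈ maximalIdeal R) :
    MvPowerSeries (Fin s) k →+* R ⧸ Ideal.span (Set.range g) :=
  (Ideal.Quotient.mk _).comp (powerSeriesEval k x hx).toRingHom

/-- The ring map `φ : A → B` makes `B` a finite free `A`-module. -/
def IsFiniteFree {A B : Type*} [CommRing A] [CommRing B] (φ : A →+* B) : Prop :=
  letI := φ.toAlgebra
  Module.Finite A B ∧ Module.Free A B

/-- `D` is a value of the discriminant of `B` over `A` (with structure map `φ`), that is,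
`D = det (Tr (eᵢ eⱼ))` for some finite basis `e` of `B` as an `A`-module. -/
def IsDiscriminant {A B : Type*} [CommRing A] [CommRing B] (φ : A →+* B) (D : A) : Prop :=
  letI := φ.toAlgebra
  ∃ (m : ℕ) (e : Module.Basis (Fin m) A B), Algebra.discr A e = D

/-! Choose N with 𝔪^N ⊆ (f, x) and take C = N + 1. For ε in 𝔪^(Cn), two things follow. First, ε lies
in 𝔪·(f, x), so Nakayama gives (f + ε, x) = (f, x) and f + ε, x is again a system of parameters.
Second, ε lies in ((f) + (x))^n ⊆ (f) + (x)^n, so (f + ε) ⊆ (f) + 𝔪_A^n R.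

Freeness: in a Cohen-Macaulay ring every system of parameters g, x is regular
(`IsWeaklyRegular.of_supportDim_quot_nonpos`, an exchange argument), so T₁, …, Tₛ is regular on
R/(g). This module is finite over the complete ring A
(`Module.Finite.quotient_of_maximalIdeal_pow_le`), hence free
(`Module.free_of_isWeaklyRegular_of_ofList_eq_maximalIdeal`).

Congruence: R/(f) and R/(f + ε) have the same reduction modulo 𝔪_A, so lifts to R of a basis of one
also give a basis of the other (`Module.Basis.exists_quotient_basis_of_sup_eq`). In two such bases
the coordinates of any element of R agree modulo 𝔪_A^n, hence so do the multiplication matrices, the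
traces and the discriminants (`Algebra.discr_sub_discr_mem`). -/

/-! ### Systems of parameters are regular sequences -/

section SystemOfParametersRegular

open RingTheory.Sequence Module

variable {R : Type*} [CommRing R]

/-- The support dimension drops by at most the length of a sequence in the maximal ideal. -/
lemma Module.supportDim_le_supportDim_quot_ofList_add_length [IsLocalRing R] [IsNoetherianRing R]
    {M : Type*} [AddCommGroup M] [Module R M] [Module.Finite R M] (ys : List R)
    (hys : ∀ y ∈ ys, y ∈ maximalIdeal R) :
    supportDim R M ≤ supportDim R (M ⧸ (Ideal.ofList ys • ⊤ : Submodule R M)) + ys.length := by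
  induction ys generalizing M with
  | nil =>
    rw [Ideal.ofList_nil, Submodule.bot_smul]
    simpa using (supportDim_eq_of_equiv (Submodule.quotEquivOfEqBot (⊥ : Submodule R M) rfl)).ge
  | cons y ys ih =>
    have h1 := supportDim_le_supportDim_quotSMulTop_succ (M := M)
      (hys y List.mem_cons_self)
    have h2 := ih (M := QuotSMulTop y M) fun z hz => hys z (List.mem_cons_of_mem _ hz)
    rw [supportDim_eq_of_equiv (Submodule.quotOfListConsSMulTopEquivQuotSMulTopInner M y ys)]
    refine h1.trans ?_
    simp only [List.length_cons, Nat.cast_add, Nat.cast_one, ← add_assoc]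
    gcongr

lemma Module.support_subset_of_supportDim_nonpos [IsLocalRing R] {M : Type*} [AddCommGroup M]
    [Module R M] [Module.Finite R M] (h : supportDim R M ≤ 0) {p : PrimeSpectrum R}
    (hp : p ∈ support R M) : p.asIdeal = maximalIdeal R := by
  have : Nontrivial M := by
    by_contra hM
    rw [not_nontrivial_iff_subsingleton] at hM
    simp [Module.support_eq_empty] at hp
  have h0 : supportDim R M = 0 := by
    refine le_antisymm h ?_
    have := (supportDim_ne_bot_iff_nontrivial R M).mpr this
    rw [← WithBot.coe_unbot _ this]
    exact WithBot.coe_le_coe.mpr zero_le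
  rw [support_of_supportDim_eq_zero R M h0, PrimeSpectrum.mem_zeroLocus] at hp
  exact ((IsLocalRing.maximalIdeal.isMaximal R).eq_of_le p.2.ne_top hp).symm

lemma Module.supportDim_nonpos_of_support_subset [IsLocalRing R] {M : Type*} [AddCommGroup M]
    [Module R M]
    (h : ∀ p ∈ support R M, p.asIdeal = maximalIdeal R) : supportDim R M ≤ 0 := by
  rw [supportDim, Order.krullDim_nonpos_iff_forall_isMax]
  rintro ⟨p, hp⟩ ⟨q, hq⟩ _
  have : q = p := PrimeSpectrum.ext ((h q hq).trans (h p hp).symm)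
  subst this
  exact le_rfl

/-- If `w` and `y` lie in the maximal ideal, `w` is regular on `M` and `M/yM` is supported at the
maximal ideal only, then `y` is regular on `M`. -/
lemma IsSMulRegular.of_supportDim_quotSMulTop_nonpos [IsLocalRing R] [IsNoetherianRing R]
    {M : Type*} [AddCommGroup M] [Module R M] [Module.Finite R M] {w y : R}
    (hw : w ∈ maximalIdeal R) (hreg : IsSMulRegular M w)
    (hy : supportDim R (QuotSMulTop y M) ≤ 0) : IsSMulRegular M y := by
  by_contra hn
  have h : y ∈ ⋃ p ∈ associatedPrimes R M, (p : Set R) := by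
    rw [biUnion_associatedPrimes_eq_compl_regular]; exact hn
  obtain ⟨p, hp, hyp⟩ := Set.mem_iUnion₂.mp h
  -- An associated prime containing `y` lies in the support of M/yM, so it is the maximal ideal and
  -- contains the regular element `w`.
  have hsupp : (⟨p, hp.isPrime⟩ : PrimeSpectrum R) ∈ support R (QuotSMulTop y M) := by
    rw [support_quotSMulTop]
    refine ⟨mem_support_iff_of_finite.mpr 
      ((Submodule.annihilator_top (R := R) (M := M)).ge.trans hp.annihilator_le), ?_⟩
    simpa using hyp
  have hpm : p = maximalIdeal R := support_subset_of_supportDim_nonpos hy hsupp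
  have : w ∈ ⋃ p ∈ associatedPrimes R M, (p : Set R) :=
    Set.mem_iUnion₂.mpr ⟨p, hp, by rw [hpm]; exact hw⟩
  rw [biUnion_associatedPrimes_eq_compl_regular] at this
  exact this hreg

/-- Prime avoidance for finitely many primes different from the maximal ideal. -/
lemma IsLocalRing.exists_mem_maximalIdeal_notMem_of_finite [IsLocalRing R]
    {S : Set (Ideal R)} (hS : S.Finite) (hp : ∀ p ∈ S, p.IsPrime ∧ p ≠ maximalIdeal R) :
    ∃ w ∈ maximalIdeal R, ∀ p ∈ S, w ∉ p := by
  by_contra! h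
  have hsub : (maximalIdeal R : Set R) ⊆ ⋃ p ∈ S, (p : Set R) := fun w hw => by
    obtain ⟨p, hpS, hwp⟩ := h w hw
    exact Set.mem_iUnion₂.mpr ⟨p, hpS, hwp⟩
  obtain ⟨p, hpS, hle⟩ := ((maximalIdeal R).subset_union_prime_finite hS (f := id) ⊤ ⊤
    fun p hpS _ _ => (hp p hpS).1).1 hsub
  exact (hp p hpS).2 ((IsLocalRing.maximalIdeal.isMaximal R).eq_of_le (hp p hpS).1.ne_top hle).symm

lemma Module.notMem_associatedPrimes_of_isSMulRegular [IsNoetherianRing R] {M : Type*}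
    [AddCommGroup M] [Module R M] {p : Ideal R} {w : R} (hw : w ∈ p) (hreg : IsSMulRegular M w) :
    p ∉ associatedPrimes R M := fun hp => by
  have : w ∈ ⋃ p ∈ associatedPrimes R M, (p : Set R) := Set.mem_iUnion₂.mpr ⟨p, hp, hw⟩
  rw [biUnion_associatedPrimes_eq_compl_regular] at this
  exact this hreg

/-- If a finite module admits a regular sequence of length `d` in the maximal ideal, then every
sequence of length `d` cutting its support down to the closed point is regular. -/
theorem RingTheory.Sequence.IsWeaklyRegular.of_supportDim_quot_nonpos [IsLocalRing R]
    [IsNoetherianRing R] (d : ℕ) {M : Type*} [AddCommGroup M] [Module R M] [Module.Finite R M]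
    {zs ys : List R} (hz : zs.length = d) (hzm : ∀ z ∈ zs, z ∈ maximalIdeal R) (hreg : IsWeaklyRegular M zs)
    (hy : ys.length = d) (hym : ∀ y ∈ ys, y ∈ maximalIdeal R)
    (hdim : supportDim R (M ⧸ (Ideal.ofList ys • ⊤ : Submodule R M)) ≤ 0) :
    IsWeaklyRegular M ys := by
  induction d generalizing M zs ys with
  | zero => rw [List.length_eq_zero_iff.mp hy]; exact .nil R M
  | succ d ih =>
    rcases subsingleton_or_nontrivial M with hM | hM
    · rw [isWeaklyRegular_iff]
      intro i hi a b _
      exact Subsingleton.elim _ _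
    obtain ⟨y₀, ys, rfl⟩ := List.exists_cons_of_length_eq_add_one hy
    obtain ⟨zs, z₀, rfl⟩ := List.eq_nil_or_concat' zs |>.resolve_left (by rintro rfl; simp at hz)
    simp only [List.length_append, List.length_cons, List.length_nil, zero_add,
      Nat.add_right_cancel_iff] at hz hy
    have hys : ∀ y ∈ ys, y ∈ maximalIdeal R := fun y h => hym y (List.mem_cons_of_mem _ h)
    have hy₀ : y₀ ∈ maximalIdeal R := hym y₀ List.mem_cons_self
    have hz₀ : z₀ ∈ maximalIdeal R := hzm z₀ (by simp)
    have hzs : ∀ z ∈ zs, z ∈ maximalIdeal R := fun z h => hzm z (by simp [h])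
    have hdimM : (d + 1 : ℕ) ≤ supportDim R M := by
      have := supportDim_add_length_eq_supportDim_of_isRegular _
        (IsRegular.of_isWeaklyRegular_of_mem_maximalIdeal M hzm hreg)
      rw [← this, List.length_append, List.length_singleton, hz]
      have hnn : Nontrivial (M ⧸ (Ideal.ofList (zs ++ [z₀]) • ⊤ : Submodule R M)) :=
        (IsRegular.of_isWeaklyRegular_of_mem_maximalIdeal M hzm hreg).quot_ofList_smul_nontrivial ⊤
      have h0 : 0 ≤ supportDim R (M ⧸ (Ideal.ofList (zs ++ [z₀]) • ⊤ : Submodule R M)) := by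
        have := (supportDim_ne_bot_iff_nontrivial R _).mpr hnn
        rw [← WithBot.coe_unbot _ this]
        exact WithBot.coe_le_coe.mpr zero_le
      simpa using add_le_add_left h0 ((d + 1 : ℕ) : WithBot ℕ∞)
    obtain ⟨hregz, hreg₀⟩ := (isWeaklyRegular_append_iff M zs [z₀]).mp hreg
    rw [isWeaklyRegular_singleton_iff] at hreg₀
    set N := M ⧸ (Ideal.ofList ys • ⊤ : Submodule R M) with hN
    have hNy : supportDim R (QuotSMulTop y₀ N) ≤ 0 := by
      rwa [supportDim_eq_of_equiv
        (Submodule.quotOfListConsSMulTopEquivQuotSMulTopOuter M y₀ ys)] at hdim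
    have hN1 : supportDim R N ≤ 1 :=
      (supportDim_le_supportDim_quotSMulTop_succ hy₀).trans (by
        simpa using add_le_add_left hNy 1)
    -- Otherwise N would be supported at the closed point, and the d elements `ys` would force dim M
    -- ≤ d.
    have hNmin : maximalIdeal R ∉ (annihilator R N).minimalPrimes := by
      intro hmin
      have h0 : supportDim R N ≤ 0 := supportDim_nonpos_of_support_subset fun p hp => by
        have h1 := hmin.2 ⟨p.2, mem_support_iff_of_finite.mp hp⟩ (le_maximalIdeal p.2.ne_top)
        exact le_antisymm (le_maximalIdeal p.2.ne_top) h1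
      have h1 := supportDim_le_supportDim_quot_ofList_add_length (M := M) ys hys
      have h2 : supportDim R M ≤ (d : ℕ) := h1.trans (by
        simpa [hy] using add_le_add_left h0 (d : WithBot ℕ∞))
      have := hdimM.trans h2
      norm_cast at this
      omega
    -- The exchange element: `w` can replace `z₀` after `zs` (it avoids the associated primes of
    -- M/(zs)M) and `y₀` after `ys` (it cuts the dimension of N to zero).
    obtain ⟨w, hw, hwp⟩ := IsLocalRing.exists_mem_maximalIdeal_notMem_of_finite
      (S := associatedPrimes R (M ⧸ (Ideal.ofList zs • ⊤ : Submodule R M)) ∪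
        (annihilator R N).minimalPrimes)
      ((associatedPrimes.finite R _).union (Ideal.finite_minimalPrimes_of_isNoetherianRing R _))
      (by
        rintro p (hp | hp)
        · exact ⟨hp.isPrime, fun h =>
            notMem_associatedPrimes_of_isSMulRegular (h ▸ hz₀ : z₀ ∈ p) hreg₀ hp⟩
        · exact ⟨hp.1.1, fun h => hNmin (h ▸ hp)⟩)
    have hwz : IsSMulRegular (M ⧸ (Ideal.ofList zs • ⊤ : Submodule R M)) w := by
      by_contra hn
      have h : w ∈ ⋃ p ∈ associatedPrimes R (M ⧸ (Ideal.ofList zs • ⊤ : Submodule R M)),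
          (p : Set R) := by
        rw [biUnion_associatedPrimes_eq_compl_regular]; exact hn
      obtain ⟨p, hp, hyp⟩ := Set.mem_iUnion₂.mp h
      exact hwp p (Or.inl hp) hyp
    have hzw : IsWeaklyRegular M (w :: zs) := by
      refine IsLocalRing.isWeaklyRegular_of_perm_of_subset_maximalIdeal (rs := zs ++ [w])
        ((isWeaklyRegular_append_iff M zs [w]).mpr
          ⟨hregz, (isWeaklyRegular_singleton_iff _ w).mpr hwz⟩) (List.perm_append_singleton w zs) ?_
      simpa [or_imp, forall_and] using ⟨hzs, hw⟩
    obtain ⟨hwM, hzwM⟩ := (isWeaklyRegular_cons_iff M w zs).mp hzw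
    have hNw : supportDim R (QuotSMulTop w N) ≤ 0 := by
      have := (supportDim_quotSMulTop_succ_eq_of_notMem_minimalPrimes_of_mem_maximalIdeal
        (M := N) (fun p hp => hwp p (Or.inr hp)) hw).trans_le hN1
      generalize supportDim R (QuotSMulTop w N) = a at this
      induction a with
      | bot => exact bot_le
      | coe a =>
        induction a with
        | top => exact absurd this (by decide)
        | coe a => norm_cast at this ⊢; omega
    -- On M/wM the sequence `zs` is regular and `ys` cuts the support down to the closed point, so
    -- induction applies.
    have hyw : IsWeaklyRegular (QuotSMulTop w M) ys := by
      refine ih hz hzs hzwM hy hys ?_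
      rwa [← supportDim_eq_of_equiv
        (Submodule.quotOfListConsSMulTopEquivQuotSMulTopInner M w ys), supportDim_eq_of_equiv
        (Submodule.quotOfListConsSMulTopEquivQuotSMulTopOuter M w ys)]
    have hyw' : IsWeaklyRegular M (ys ++ [w]) :=
      IsLocalRing.isWeaklyRegular_of_perm_of_subset_maximalIdeal
        ((isWeaklyRegular_cons_iff M w ys).mpr ⟨hwM, hyw⟩)
        (List.perm_append_singleton w ys).symm (by simpa using ⟨hw, hys⟩)
    obtain ⟨hysM, hwN⟩ := (isWeaklyRegular_append_iff M ys [w]).mp hyw'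
    rw [isWeaklyRegular_singleton_iff] at hwN
    refine IsLocalRing.isWeaklyRegular_of_perm_of_subset_maximalIdeal
      ((isWeaklyRegular_append_iff M ys [y₀]).mpr ⟨hysM, (isWeaklyRegular_singleton_iff _ y₀).mpr
        (IsSMulRegular.of_supportDim_quotSMulTop_nonpos hw hwN hNy)⟩)
      (List.perm_append_singleton y₀ ys) ?_
    simpa [or_imp, forall_and] using ⟨hys, hy₀⟩

end SystemOfParametersRegular

/-! ### Finiteness and freeness over a complete local ring -/

section FiniteFree

open RingTheory.Sequence

/-- A finite module over a Noetherian local ring on which a sequence generating the maximal ideal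
is regular is free. -/
theorem Module.free_of_isWeaklyRegular_of_ofList_eq_maximalIdeal {A M : Type*} [CommRing A]
    [IsLocalRing A] [IsNoetherianRing A] [AddCommGroup M] [Module A M] [Module.Finite A M]
    (ts : List A) (hts : Ideal.ofList ts = maximalIdeal A) (hreg : IsWeaklyRegular M ts) :
    Module.Free A M := by
  obtain ⟨n, hn⟩ : ∃ n, ts.length = n := ⟨_, rfl⟩
  induction n generalizing A M with
  | zero =>
    obtain rfl := List.length_eq_zero_iff.mp hn
    have hA : IsField A := by
      rw [IsLocalRing.isField_iff_maximalIdeal_eq, ← hts, Ideal.ofList_nil]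
    let := hA.toField
    exact Module.Free.of_divisionRing A M
  | succ n ih =>
    obtain ⟨t, ts, rfl⟩ := List.exists_cons_of_length_eq_add_one hn
    have ht : t ∈ maximalIdeal A := hts ▸ Ideal.subset_span (by simp)
    obtain ⟨h1, h2⟩ := (isWeaklyRegular_cons_iff' M t ts).mp hreg
    have : Nontrivial (A ⧸ Ideal.span {t}) := Ideal.Quotient.nontrivial_iff.mpr fun h => by
      rw [Ideal.span_singleton_eq_top] at h
      exact ht h
    have : IsLocalRing (A ⧸ Ideal.span {t}) := .of_surjective' _ Ideal.Quotient.mk_surjective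
    have : Module.FinitePresentation A M := Module.finitePresentation_of_finite A M
    have : Module.Finite (A ⧸ Ideal.span {t}) (QuotSMulTop t M) :=
      Module.Finite.of_restrictScalars_finite A _ _
    -- Since `t` is M-regular and in the Jacobson radical, freeness of M/tM over A/(t) lifts to M
    -- over A.
    rw [← Module.free_quotSMulTop_iff_free A M (maximalIdeal_le_jacobson _ ht) h1]
    refine ih (ts.map (Ideal.Quotient.mk (Ideal.span {t}))) ?_ h2 (by simpa using hn)
    rw [← Ideal.map_ofList, ← IsLocalRing.map_maximalIdeal_of_surjective
      (Ideal.Quotient.mk (Ideal.span {t})) Ideal.Quotient.mk_surjective, ← hts, Ideal.ofList_cons,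
      Ideal.map_sup]
    simp [Ideal.map_span]

/-- Limits are taken coordinatewise. This makes a finite free module over a complete ring a
legitimate source for the complete Nakayama lemma. -/
instance IsPrecomplete.pi {A ι : Type*} [CommRing A] [Finite ι] (I : Ideal A)
    [IsPrecomplete I A] : IsPrecomplete I (ι → A) where
  prec' f hf := by
    classical
    cases nonempty_fintype ι
    have hmem (n : ℕ) (v : ι → A) :
        v ∈ (I ^ n • ⊤ : Submodule A (ι → A)) ↔ ∀ i, v i ∈ I ^ n := by
      constructor
      · intro hv i
        have := Submodule.mem_map_of_mem (f := LinearMap.proj (R := A) i) hv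
        rw [Submodule.map_smul''] at this
        simpa using Submodule.smul_mono le_rfl le_top this
      · intro hv
        rw [pi_eq_sum_univ' v]
        refine Submodule.sum_mem _ fun i _ => Submodule.smul_mem_smul (hv i) trivial
    have hc (i : ι) : ∃ L : A, ∀ n, f n i ≡ L [SMOD (I ^ n • ⊤ : Submodule A A)] :=
      IsPrecomplete.prec' (fun n => f n i) fun {m n} hmn => by
        have := (hmem _ _).mp (SModEq.sub_mem.mp (hf hmn)) i
        rw [SModEq.sub_mem]
        simpa using this
    choose L hL using hc
    refine ⟨L, fun n => SModEq.sub_mem.mpr ((hmem _ _).mpr fun i => ?_)⟩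
    simpa using SModEq.sub_mem.mp (hL i n)

variable {A R : Type*} [CommRing A] [CommRing R] [IsLocalRing R]
  [IsNoetherianRing R] [Algebra A R]

/-- If `A` surjects onto the residue field of `R`, then `R/𝔪ⁿ` is a finite `A`-module. -/
lemma IsLocalRing.exists_span_sup_maximalIdeal_pow_eq_top
    (hres : Function.Surjective ((residue R).comp (algebraMap A R))) (n : ℕ) :
    ∃ S : Set R, S.Finite ∧
      Submodule.span A S ⊔ (maximalIdeal R ^ n).restrictScalars A = ⊤ := by
  induction n with
  | zero => exact ⟨∅, Set.finite_empty, by simp [Ideal.one_eq_top]⟩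
  | succ n ih =>
    obtain ⟨S, hS, hSn⟩ := ih
    obtain ⟨U, hU⟩ := (IsNoetherian.noetherian (maximalIdeal R ^ n) : (maximalIdeal R ^ n).FG)
    refine ⟨S ∪ U, hS.union U.finite_toSet, top_unique (hSn.ge.trans (sup_le ?_ ?_))⟩
    · exact (Submodule.span_mono Set.subset_union_left).trans le_sup_left
    · intro r hr
      rw [Submodule.restrictScalars_mem, ← hU] at hr
      induction hr using Submodule.span_induction with
      | mem u hu => exact Submodule.mem_sup_left (Submodule.subset_span (Or.inr hu))
      | zero => exact zero_mem _
      | add a b _ _ ha hb => exact add_mem ha hb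
      | smul a u hu hu' =>
        obtain ⟨c, hc⟩ := hres (residue R a)
        have hac : a - algebraMap A R c ∈ maximalIdeal R := by
          rw [← residue_eq_zero_iff, map_sub, ← hc, RingHom.comp_apply, sub_self]
        have h : a • u = c • u + (a - algebraMap A R c) * u := by
          rw [smul_eq_mul, Algebra.smul_def]; ring
        rw [h]
        refine add_mem (Submodule.smul_mem _ _ hu') (Submodule.mem_sup_right ?_)
        rw [Submodule.restrictScalars_mem, pow_succ']
        exact Ideal.mul_mem_mul hac (hU ▸ hu)

/-- A complete local version of Nakayama's lemma: a quotient `R/J` is finite over a complete ring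
`A` if `J + 𝔪_A R` is primary to the maximal ideal. -/
lemma Module.Finite.quotient_of_maximalIdeal_pow_le [IsLocalRing A]
    [IsPrecomplete (maximalIdeal A) A]
    (hres : Function.Surjective ((residue R).comp (algebraMap A R)))
    (hA : (maximalIdeal A).map (algebraMap A R) ≤ maximalIdeal R) (J : Ideal R) {N : ℕ}
    (hN : maximalIdeal R ^ N ≤ J ⊔ (maximalIdeal A).map (algebraMap A R)) :
    Module.Finite A (R ⧸ J) := by
  obtain ⟨S, hS, hSN⟩ := exists_span_sup_maximalIdeal_pow_eq_top hres N
  have : Finite S := hS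
  cases nonempty_fintype S
  -- The 𝔪_A-adic filtration is finer than the 𝔪_R-adic one, which is separated by Krull's
  -- intersection theorem.
  have : IsHausdorff (maximalIdeal A) (R ⧸ J) := by
    refine ⟨fun v hv => ?_⟩
    refine IsHausdorff.haus' (I := maximalIdeal R) v fun n => ?_
    have := hv n
    clear hv
    rw [SModEq.zero] at this ⊢
    induction this using Submodule.smul_induction_on' with
    | smul a ha b _ =>
      rw [← algebraMap_smul R a b]
      refine Submodule.smul_mem_smul (Ideal.pow_right_mono hA n ?_) trivial
      rw [← Ideal.map_pow]
      exact Ideal.mem_map_of_mem _ ha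
    | add a _ b _ ha hb => exact add_mem ha hb
  let g : (S → A) →ₗ[A] R ⧸ J := Fintype.linearCombination A fun s : S => Ideal.Quotient.mk J s
  have hg : Function.Surjective g := by
    -- With a precomplete source and a separated target, surjectivity may be checked modulo 𝔪_A.
    refine surjective_of_mkQ_comp_surjective (I := maximalIdeal A) ?_
    rw [← LinearMap.range_eq_top, LinearMap.range_comp, ← top_le_iff,
      ← Submodule.comap_le_comap_iff_of_surjective (Submodule.mkQ_surjective _),
      Submodule.comap_map_mkQ, Submodule.comap_top, Fintype.range_linearCombination]
    rintro v -
    obtain ⟨r, rfl⟩ := Ideal.Quotient.mk_surjective v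
    obtain ⟨a, ha, b, hb, rfl⟩ := Submodule.mem_sup.mp (hSN.ge (Submodule.mem_top (x := r)))
    obtain ⟨j, hj, u, hu, rfl⟩ := Submodule.mem_sup.mp (hN hb)
    have hmap (K : Submodule A R) {z : R} (hz : z ∈ K) :=
      Submodule.mem_map_of_mem (f := (Ideal.Quotient.mkₐ A J).toLinearMap) hz
    have hu' : u ∈ (maximalIdeal A • ⊤ : Submodule A R) := by rwa [Ideal.smul_top_eq_map]
    rw [map_add, map_add, Ideal.Quotient.eq_zero_iff_mem.mpr hj, zero_add, add_comm]
    refine add_mem (Submodule.mem_sup_left ?_) (Submodule.mem_sup_right ?_)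
    · have := hmap _ hu'
      rw [Submodule.map_smul''] at this
      exact Submodule.smul_mono le_rfl le_top this
    · have := hmap _ ha
      rw [Submodule.map_span, Set.image_eq_range] at this
      exact this
  exact Module.Finite.of_surjective g hg

end FiniteFree

/-! ### Congruence of coordinates and discriminants -/

section DiscriminantCongruence

variable {A R : Type*} [CommRing A] [CommRing R] [Algebra A R]

/-- Coordinates of `r : R` in bases of `R/J₁` and `R/J₂` with common lifts are congruent. -/
lemma Module.Basis.repr_mk_sub_repr_mk_mem {ι : Type*} [Finite ι] {J₁ J₂ : Ideal R} {I : Ideal A}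
    (hJ : J₂ ≤ J₁ ⊔ I.map (algebraMap A R)) (e : ι → R) (b₁ : Module.Basis ι A (R ⧸ J₁))
    (b₂ : Module.Basis ι A (R ⧸ J₂)) (h₁ : ∀ i, b₁ i = Ideal.Quotient.mk J₁ (e i))
    (h₂ : ∀ i, b₂ i = Ideal.Quotient.mk J₂ (e i)) (r : R) (i : ι) :
    b₁.repr (Ideal.Quotient.mk J₁ r) i - b₂.repr (Ideal.Quotient.mk J₂ r) i ∈ I := by
  cases nonempty_fintype ι
  set u := fun j => b₂.repr (Ideal.Quotient.mk J₂ r) j with hu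
  -- Read modulo J₁, this element lies in I·(R/J₁), so its `b₁`-coordinates, which are the
  -- differences sought, lie in I.
  have hr : r - ∑ j, u j • e j ∈ J₂ := by
    rw [← Ideal.Quotient.eq_zero_iff_mem, map_sub, sub_eq_zero]
    conv_lhs => rw [← b₂.sum_repr (Ideal.Quotient.mk J₂ r)]
    simp only [map_sum, h₂]
    rfl
  obtain ⟨j, hj, y, hy, hjy⟩ := Submodule.mem_sup.mp (hJ hr)
  have hmk : Ideal.Quotient.mk J₁ r - ∑ j, u j • b₁ j = Ideal.Quotient.mk J₁ y := by
    have := congrArg (Ideal.Quotient.mk J₁) hjy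
    rw [map_add, Ideal.Quotient.eq_zero_iff_mem.mpr hj, zero_add] at this
    rw [this, map_sub, map_sum]
    simp only [h₁]
    rfl
  have hyI : Ideal.Quotient.mk J₁ y ∈ (I • ⊤ : Submodule A (R ⧸ J₁)) := by
    have hy' : y ∈ (I • ⊤ : Submodule A R) := by rwa [Ideal.smul_top_eq_map]
    have := Submodule.mem_map_of_mem (f := (Ideal.Quotient.mkₐ A J₁).toLinearMap) hy'
    rw [Submodule.map_smul''] at this
    exact Submodule.smul_mono le_rfl le_top this
  have hcoord : b₁.coord i (Ideal.Quotient.mk J₁ y) ∈ I := by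
    have := Submodule.mem_map_of_mem (f := b₁.coord i) hyI
    rw [Submodule.map_smul''] at this
    simpa using Submodule.smul_mono le_rfl le_top this
  rw [← hmk, map_sub, map_sum] at hcoord
  classical
  simpa [Finsupp.single_apply] using hcoord

/-- Discriminants of bases of `R/J₁` and `R/J₂` with common lifts are congruent modulo `I`, if
`J₁` and `J₂` agree modulo `I`. -/
lemma Algebra.discr_sub_discr_mem {ι : Type*} [Fintype ι] [DecidableEq ι] {J₁ J₂ : Ideal R}
    {I : Ideal A} (hJ : J₂ ≤ J₁ ⊔ I.map (algebraMap A R)) (e : ι → R)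
    (b₁ : Module.Basis ι A (R ⧸ J₁)) (b₂ : Module.Basis ι A (R ⧸ J₂))
    (h₁ : ∀ i, b₁ i = Ideal.Quotient.mk J₁ (e i)) (h₂ : ∀ i, b₂ i = Ideal.Quotient.mk J₂ (e i)) :
    Algebra.discr A b₁ - Algebra.discr A b₂ ∈ I := by
  rw [← Ideal.Quotient.eq, Algebra.discr_def, Algebra.discr_def, RingHom.map_det, RingHom.map_det]
  congr 1
  ext i j
  simp only [RingHom.mapMatrix_apply, Matrix.map_apply, Algebra.traceMatrix_apply,
    Algebra.traceForm_apply, Algebra.trace_eq_matrix_trace b₁, Algebra.trace_eq_matrix_trace b₂,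
    Matrix.trace, Matrix.diag, map_sum, Algebra.leftMulMatrix_eq_repr_mul, h₁, h₂, ← map_mul]
  refine Finset.sum_congr rfl fun l _ => ?_
  exact Ideal.Quotient.eq.mpr (Module.Basis.repr_mk_sub_repr_mk_mem hJ e b₁ b₂ h₁ h₂ _ l)

end DiscriminantCongruence

/-! ### Transfer of bases between quotients -/

section BasisTransfer

variable {A R : Type*} [CommRing A] [IsLocalRing A] [CommRing R] [Algebra A R]

/-- Lifts of a spanning family of `R/J₁` span `R/J₂`, if `J₁` and `J₂` agree modulo `𝔪_A`. -/
lemma Ideal.Quotient.span_range_mk_eq_top_of_sup_eq {ι : Type*} {J₁ J₂ : Ideal R}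
    [Module.Finite A (R ⧸ J₂)]
    (hJ : J₁ ≤ J₂ ⊔ (maximalIdeal A).map (algebraMap A R)) (e : ι → R)
    (h : Submodule.span A (Set.range fun i => Ideal.Quotient.mk J₁ (e i)) = ⊤) :
    Submodule.span A (Set.range fun i => Ideal.Quotient.mk J₂ (e i)) = ⊤ := by
  have himage (J : Ideal R) : Submodule.span A (Set.range fun i => Ideal.Quotient.mk J (e i)) =
      (Submodule.span A (Set.range e)).map (Ideal.Quotient.mkₐ A J).toLinearMap := by
    rw [Submodule.map_span, ← Set.range_comp]
    rfl
  -- Nakayama over A: the lifts need only span R/J₂ modulo 𝔪_A.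
  refine top_unique (Submodule.le_of_le_smul_of_le_jacobson_bot Module.Finite.fg_top
    (maximalIdeal_le_jacobson _) ?_)
  rintro v -
  obtain ⟨r, rfl⟩ := Ideal.Quotient.mk_surjective v
  have hr : Ideal.Quotient.mk J₁ r ∈
      (Submodule.span A (Set.range e)).map (Ideal.Quotient.mkₐ A J₁).toLinearMap := by
    rw [← himage, h]
    trivial
  obtain ⟨t, ht, htr⟩ := hr
  have hrt : r - t ∈ J₁ := Ideal.Quotient.eq.mp htr.symm
  obtain ⟨j, hj, u, hu, hju⟩ := Submodule.mem_sup.mp (hJ hrt)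
  have hru : Ideal.Quotient.mk J₂ r = Ideal.Quotient.mk J₂ t + Ideal.Quotient.mk J₂ u := by
    rw [← map_add, Ideal.Quotient.eq]
    convert! hj using 1
    linear_combination -hju
  rw [hru, himage]
  refine add_mem (Submodule.mem_sup_left (Submodule.mem_map_of_mem ht))
    (Submodule.mem_sup_right ?_)
  have hu' : u ∈ (maximalIdeal A • ⊤ : Submodule A R) := by rwa [Ideal.smul_top_eq_map]
  have := Submodule.mem_map_of_mem (f := (Ideal.Quotient.mkₐ A J₂).toLinearMap) hu'
  rw [Submodule.map_smul''] at this
  exact Submodule.smul_mono le_rfl le_top this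

lemma Module.finrank_quotient_le_of_sup_eq {J₁ J₂ : Ideal R} [Module.Finite A (R ⧸ J₁)]
    [Module.Free A (R ⧸ J₁)] [Module.Finite A (R ⧸ J₂)]
    (hJ : J₁ ≤ J₂ ⊔ (maximalIdeal A).map (algebraMap A R)) :
    Module.finrank A (R ⧸ J₂) ≤ Module.finrank A (R ⧸ J₁) := by
  let b := Module.finBasis A (R ⧸ J₁)
  choose e he using fun i => Ideal.Quotient.mk_surjective (b i)
  have := finrank_le_of_span_eq_top (Ideal.Quotient.span_range_mk_eq_top_of_sup_eq hJ e
    (by simp only [he]; exact b.span_eq))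
  simpa using this

/-- Lifts of a basis of `R/J₁` form a basis of `R/J₂`, if `J₁` and `J₂` agree modulo `𝔪_A`. -/
lemma Module.Basis.exists_quotient_basis_of_sup_eq {m : ℕ} {J₁ J₂ : Ideal R}
    [Module.Finite A (R ⧸ J₁)] [Module.Free A (R ⧸ J₁)] [Module.Finite A (R ⧸ J₂)]
    [Module.Free A (R ⧸ J₂)]
    (h₁₂ : J₁ ≤ J₂ ⊔ (maximalIdeal A).map (algebraMap A R))
    (h₂₁ : J₂ ≤ J₁ ⊔ (maximalIdeal A).map (algebraMap A R))
    (b₁ : Module.Basis (Fin m) A (R ⧸ J₁)) (e : Fin m → R)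
    (he : ∀ i, b₁ i = Ideal.Quotient.mk J₁ (e i)) :
    ∃ b₂ : Module.Basis (Fin m) A (R ⧸ J₂), ∀ i, b₂ i = Ideal.Quotient.mk J₂ (e i) := by
  have hrank : Module.finrank A (R ⧸ J₂) = m := by
    rw [le_antisymm (finrank_quotient_le_of_sup_eq h₁₂) (finrank_quotient_le_of_sup_eq h₂₁),
      Module.finrank_eq_card_basis b₁, Fintype.card_fin]
  let b := Module.finBasisOfFinrankEq A (R ⧸ J₂) hrank
  let φ : (R ⧸ J₂) →ₗ[A] R ⧸ J₂ := b.constr A fun i => Ideal.Quotient.mk J₂ (e i)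
  have hφ : Function.Surjective φ := by
    rw [← LinearMap.range_eq_top, Module.Basis.constr_range]
    refine Ideal.Quotient.span_range_mk_eq_top_of_sup_eq h₁₂ e ?_
    simp only [← he]
    exact b₁.span_eq
  -- The ranks agree, so the spanning lifts are the image of a basis under a surjective endomorphism
  -- of a finite module, which is bijective.
  refine ⟨b.map (LinearEquiv.ofBijective φ
    (OrzechProperty.bijective_of_surjective_endomorphism φ hφ)),
    fun i => ?_⟩
  simp [φ]

end BasisTransfer

/-! ### Ring maps versus algebra instances -/

section Transport

lemma isFiniteFree_algebraMap_iff {A B : Type*} [CommRing A] [CommRing B] [i : Algebra A B] :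
    IsFiniteFree (algebraMap A B) ↔ Module.Finite A B ∧ Module.Free A B := by
  have h : (algebraMap A B).toAlgebra = i := Algebra.algebra_ext _ _ fun _ => rfl
  unfold IsFiniteFree
  rw [h]

lemma isDiscriminant_algebraMap_iff {A B : Type*} [CommRing A] [CommRing B] [i : Algebra A B]
    {D : A} : IsDiscriminant (algebraMap A B) D ↔
      ∃ (m : ℕ) (e : Module.Basis (Fin m) A B), Algebra.discr A e = D := by
  have h : (algebraMap A B).toAlgebra = i := Algebra.algebra_ext _ _ fun _ => rfl
  unfold IsDiscriminant
  rw [h]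

end Transport

/-! ### The maximal ideal of a power series ring -/

section PowerSeries

/-- A power series without terms in the monomials prime to the variables in `s` lies in the ideal
generated by these variables. -/
lemma MvPowerSeries.mem_span_X_image {σ k : Type*} [CommRing k] (s : Finset σ)
    (p : MvPowerSeries σ k) (hp : ∀ d : σ →₀ ℕ, (∀ i ∈ s, d i = 0) → coeff d p = 0) :
    p ∈ Ideal.span ((X : σ → MvPowerSeries σ k) '' s) := by
  classical
  induction s using Finset.induction_on generalizing p with
  | empty =>
    have : p = 0 := ext fun d => hp d (by simp)
    rw [this]
    exact zero_mem _
  | insert a s _ ih =>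
    -- `q` is the part of `p` free of the variable `a`; the rest is divisible by that variable.
    let q : MvPowerSeries σ k := fun d => if d a = 0 then coeff d p else 0
    have hq (d : σ →₀ ℕ) : coeff d q = if d a = 0 then coeff d p else 0 := rfl
    rw [← sub_add_cancel p q]
    refine add_mem ?_ (Ideal.span_mono (Set.image_mono (by simp)) (ih q fun d hd => ?_))
    · refine Ideal.mem_of_dvd _ (X_dvd_iff.mpr fun d hd => ?_)
        (Ideal.subset_span ⟨a, by simp, rfl⟩)
      rw [map_sub, hq, if_pos hd, sub_self]
    · rw [hq]
      split_ifs with h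
      · exact hp d (by simpa [h] using hd)
      · rfl

lemma MvPowerSeries.span_range_X_eq_maximalIdeal (σ k : Type*) [Finite σ] [Field k] :
    Ideal.span (Set.range (X : σ → MvPowerSeries σ k)) = maximalIdeal (MvPowerSeries σ k) := by
  cases nonempty_fintype σ
  refine le_antisymm (Ideal.span_le.mpr ?_) fun p hp => ?_
  · rintro _ ⟨i, rfl⟩
    rw [SetLike.mem_coe, mem_maximalIdeal, mem_nonunits_iff, isUnit_iff_constantCoeff]
    simp
  · rw [mem_maximalIdeal, mem_nonunits_iff, isUnit_iff_constantCoeff, isUnit_iff_ne_zero,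
      not_not] at hp
    have := mem_span_X_image Finset.univ p fun d hd => by
      have : d = 0 := Finsupp.ext fun i => hd i (Finset.mem_univ i)
      rw [this, coeff_zero_eq_constantCoeff_apply, hp]
    simpa using this

end PowerSeries

/-! ### Perturbing the generators of an ideal -/

section Perturbation

variable {R : Type*} [CommRing R]

/-- Every mixed term of the product has a factor in `I`. -/
lemma Ideal.sup_pow_le_sup_pow (I J : Ideal R) (n : ℕ) : (I ⊔ J) ^ n ≤ I ⊔ J ^ n := by
  induction n with
  | zero => simp
  | succ n ih =>
    rw [pow_succ, pow_succ]
    refine (Ideal.mul_mono_left ih).trans ?_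
    rw [Ideal.sup_mul]
    refine sup_le (Ideal.mul_le_left.trans le_sup_left) ?_
    rw [Ideal.mul_sup]
    exact sup_le_sup Ideal.mul_le_right le_rfl

lemma Ideal.span_range_append {m n : ℕ} (f : Fin m → R) (x : Fin n → R) :
    Ideal.span (Set.range (Fin.append f x)) =
      Ideal.span (Set.range f) ⊔ Ideal.span (Set.range x) := by
  rw [← Ideal.span_union]
  congr 1
  ext r
  simp only [Set.mem_range, Set.mem_union]
  constructor
  · rintro ⟨i, rfl⟩
    induction i using Fin.addCases with
    | left i => exact Or.inl ⟨i, by simp⟩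
    | right i => exact Or.inr ⟨i, by simp⟩
  · rintro (⟨i, rfl⟩ | ⟨i, rfl⟩)
    · exact ⟨Fin.castAdd n i, by simp⟩
    · exact ⟨Fin.natAdd m i, by simp⟩

/-- Perturbing `f` by elements of `𝔪 (f, x)` does not change the ideal `(f, x)`. -/
lemma Ideal.span_add_sup_span_eq_of_mem_maximalIdeal_mul [IsLocalRing R] [IsNoetherianRing R]
    {ι : Type*} (f ε : ι → R) (K : Ideal R)
    (hε : ∀ i, ε i ∈ maximalIdeal R * (Ideal.span (Set.range f) ⊔ K)) :
    Ideal.span (Set.range (f + ε)) ⊔ K = Ideal.span (Set.range f) ⊔ K := by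
  have hε' (i : ι) : ε i ∈ Ideal.span (Set.range f) ⊔ K := Ideal.mul_le_right (hε i)
  refine le_antisymm (sup_le (Ideal.span_le.mpr ?_) le_sup_right) ?_
  · rintro _ ⟨i, rfl⟩
    exact add_mem (Ideal.mem_sup_left (Ideal.subset_span ⟨i, rfl⟩)) (hε' i)
  · refine Submodule.le_of_le_smul_of_le_jacobson_bot (I := maximalIdeal R)
      (IsNoetherian.noetherian _) (maximalIdeal_le_jacobson _) (sup_le (Ideal.span_le.mpr ?_)
        (le_sup_right.trans le_sup_left))
    rintro _ ⟨i, rfl⟩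
    have : f i = (f + ε) i - ε i := by simp
    rw [this]
    exact sub_mem (Submodule.mem_sup_left (Ideal.mem_sup_left (Ideal.subset_span ⟨i, rfl⟩)))
      (Submodule.mem_sup_right (hε i))

end Perturbation

/-! ### Assembly over a general complete base, then over power series -/

section Main

open RingTheory.Sequence

/-- Every system of parameters of a Cohen-Macaulay local ring is a regular sequence. -/
theorem IsSystemOfParameters.isWeaklyRegular {R : Type*} [CommRing R] [IsLocalRing R]
    [IsCohenMacaulayLocal R] {d : ℕ} {y : Fin d → R} (hy : IsSystemOfParameters y) :
    IsWeaklyRegular R (List.ofFn y) := by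
  have : IsNoetherianRing R := IsCohenMacaulayLocal.noetherian
  obtain ⟨rs, hrs, hreg, hlen⟩ := IsCohenMacaulayLocal.exists_regular (R := R)
  have hlen' : rs.length = d := by
    rw [hy.dim_eq] at hlen
    exact_mod_cast hlen
  refine hreg.toIsWeaklyRegular.of_supportDim_quot_nonpos d hlen' hrs (by simp) ?_ ?_
  · intro z hz
    obtain ⟨i, rfl⟩ := (List.mem_ofFn' _ _).mp hz
    exact hy.mem i
  · refine Module.supportDim_nonpos_of_support_subset fun p hp => ?_
    refine le_antisymm (le_maximalIdeal p.2.ne_top) ?_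
    rw [← hy.radical_eq, p.2.radical_le_iff]
    refine Ideal.span_le.mpr ?_
    rintro _ ⟨i, rfl⟩
    refine Module.mem_support_iff_of_finite.mp hp (Module.mem_annihilator.mpr fun v => ?_)
    obtain ⟨v, rfl⟩ := Submodule.Quotient.mk_surjective _ v
    rw [← Submodule.Quotient.mk_smul, Submodule.Quotient.mk_eq_zero]
    exact Submodule.smul_mem_smul (Ideal.subset_span ((List.mem_ofFn' _ _).mpr ⟨i, rfl⟩)) trivial

lemma IsSystemOfParameters.exists_maximalIdeal_pow_le {R : Type*} [CommRing R] [IsLocalRing R]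
    [IsNoetherianRing R] {c s : ℕ} {f : Fin c → R} {x : Fin s → R}
    (h : IsSystemOfParameters (Fin.append f x)) :
    ∃ N, maximalIdeal R ^ N ≤ Ideal.span (Set.range f) ⊔ Ideal.span (Set.range x) := by
  rw [← Ideal.span_range_append, ← h.radical_eq]
  exact Ideal.exists_radical_pow_le_of_fg _ (IsNoetherian.noetherian _)

variable {A R : Type*} [CommRing A] [IsLocalRing A] [IsNoetherianRing A]
  [IsPrecomplete (maximalIdeal A) A] [CommRing R] [IsLocalRing R] [IsCohenMacaulayLocal R]
  [Algebra A R]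

/-- If `g, x` is a system of parameters of a Cohen-Macaulay local ring `R`, and `x` is the image of
generators of the maximal ideal of a complete local ring `A` over which `R` has no residue field
extension, then `R/(g)` is finite free over `A`. -/
theorem IsSystemOfParameters.finite_free_quotient {c s : ℕ} {g : Fin c → R} (t : Fin s → A)
    (ht : Ideal.span (Set.range t) = maximalIdeal A)
    (hres : Function.Surjective ((residue R).comp (algebraMap A R)))
    (h : IsSystemOfParameters (Fin.append g fun i => algebraMap A R (t i))) :
    Module.Finite A (R ⧸ Ideal.span (Set.range g)) ∧
      Module.Free A (R ⧸ Ideal.span (Set.range g)) := by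
  have : IsNoetherianRing R := IsCohenMacaulayLocal.noetherian
  have hmap : (maximalIdeal A).map (algebraMap A R) =
      Ideal.span (Set.range fun i => algebraMap A R (t i)) := by
    rw [← ht, Ideal.map_span, ← Set.range_comp]
    rfl
  obtain ⟨N, hN⟩ := h.exists_maximalIdeal_pow_le
  have hfin : Module.Finite A (R ⧸ Ideal.span (Set.range g)) := by
    refine Module.Finite.quotient_of_maximalIdeal_pow_le hres ?_ _ (hmap ▸ hN)
    rw [hmap, Ideal.span_le]
    rintro _ ⟨i, rfl⟩
    exact h.mem_right i
  refine ⟨hfin, Module.free_of_isWeaklyRegular_of_ofList_eq_maximalIdeal (List.ofFn t) ?_ ?_⟩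
  · rw [← ht]
    exact congrArg Ideal.span (Set.ext fun _ => List.mem_ofFn' _ _)
  · have hreg := h.isWeaklyRegular
    rw [List.ofFn_fin_append, isWeaklyRegular_append_iff] at hreg
    have heq : (Ideal.ofList (List.ofFn g) • ⊤ : Submodule R R) = Ideal.span (Set.range g) := by
      rw [smul_eq_mul, Ideal.mul_top]
      exact congrArg Ideal.span (Set.ext fun _ => List.mem_ofFn' _ _)
    have hreg' := ((Submodule.quotEquivOfEq _ _ heq).isWeaklyRegular_congr _).mp hreg.2
    rw [← isWeaklyRegular_map_algebraMap_iff R, List.map_ofFn]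
    exact hreg'

/-- Discriminants of `R/(f)` and of `R/(f + ε)` over `A` are congruent modulo `𝔪_A ^ n` if the
entries of `ε` lie in `𝔪_R ^ (C * n)`, with `C` independent of `n`. -/
theorem exists_forall_isDiscriminant_congruent {c s : ℕ} {f : Fin c → R} (t : Fin s → A)
    (ht : Ideal.span (Set.range t) = maximalIdeal A)
    (hres : Function.Surjective ((residue R).comp (algebraMap A R)))
    (h : IsSystemOfParameters (Fin.append f fun i => algebraMap A R (t i))) :
    ∃ C : ℕ, ∀ n : ℕ, 1 ≤ n → ∀ ε : Fin c → R, (∀ i, ε i ∈ maximalIdeal R ^ (C * n)) →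
      IsSystemOfParameters (Fin.append (f + ε) fun i => algebraMap A R (t i)) ∧
      (∀ D, IsDiscriminant (algebraMap A (R ⧸ Ideal.span (Set.range f))) D →
        ∃ D', IsDiscriminant (algebraMap A (R ⧸ Ideal.span (Set.range (f + ε)))) D' ∧
          D - D' ∈ maximalIdeal A ^ n) ∧
      (∀ D', IsDiscriminant (algebraMap A (R ⧸ Ideal.span (Set.range (f + ε)))) D' →
        ∃ D, IsDiscriminant (algebraMap A (R ⧸ Ideal.span (Set.range f))) D ∧
          D - D' ∈ maximalIdeal A ^ n) := by
  have : IsNoetherianRing R := IsCohenMacaulayLocal.noetherian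
  have hmap : (maximalIdeal A).map (algebraMap A R) =
      Ideal.span (Set.range fun i => algebraMap A R (t i)) := by
    rw [← ht, Ideal.map_span, ← Set.range_comp]
    rfl
  obtain ⟨N, hN⟩ := h.exists_maximalIdeal_pow_le
  -- The N gives 𝔪^(Nn) ⊆ (f) + 𝔪_A^n R; the extra 1 supplies the factor 𝔪 needed for Nakayama in
  -- `hsup`, where n ≥ 1 is used.
  refine ⟨N + 1, fun n hn ε hε => ?_⟩
  have hsup : Ideal.span (Set.range (f + ε)) ⊔ (maximalIdeal A).map (algebraMap A R) =
      Ideal.span (Set.range f) ⊔ (maximalIdeal A).map (algebraMap A R) := by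
    refine Ideal.span_add_sup_span_eq_of_mem_maximalIdeal_mul f ε _ fun i => ?_
    have := Ideal.pow_le_pow_right (Nat.le_mul_of_pos_right (N + 1) hn) (hε i)
    rw [pow_succ'] at this
    exact Ideal.mul_mono_right (hmap ▸ hN) this
  have hsop : IsSystemOfParameters (Fin.append (f + ε) fun i => algebraMap A R (t i)) := by
    refine ⟨h.dim_eq, ?_⟩
    rw [Ideal.span_range_append, ← hmap, hsup, hmap, ← Ideal.span_range_append, h.radical_eq]
  obtain ⟨hfin₁, hfree₁⟩ := h.finite_free_quotient t ht hres
  obtain ⟨hfin₂, hfree₂⟩ := hsop.finite_free_quotient t ht hres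
  have h₁₂ := le_sup_left.trans hsup.ge
  have h₂₁ := le_sup_left.trans hsup.le
  have hJ : Ideal.span (Set.range (f + ε)) ≤
      Ideal.span (Set.range f) ⊔ (maximalIdeal A ^ n).map (algebraMap A R) := by
    rw [Ideal.span_le]
    rintro _ ⟨i, rfl⟩
    refine add_mem (Ideal.mem_sup_left (Ideal.subset_span ⟨i, rfl⟩)) ?_
    rw [Ideal.map_pow, hmap]
    refine Ideal.sup_pow_le_sup_pow _ _ n (Ideal.pow_right_mono hN n ?_)
    rw [← pow_mul]
    exact Ideal.pow_le_pow_right (Nat.mul_le_mul_right n N.le_succ) (hε i)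
  refine ⟨hsop, fun D hD => ?_, fun D' hD' => ?_⟩
  · obtain ⟨m, b₁, rfl⟩ := isDiscriminant_algebraMap_iff.mp hD
    choose e he using fun i => Ideal.Quotient.mk_surjective (b₁ i)
    obtain ⟨b₂, hb₂⟩ := b₁.exists_quotient_basis_of_sup_eq h₁₂ h₂₁ e fun i => (he i).symm
    exact ⟨_, isDiscriminant_algebraMap_iff.mpr ⟨m, b₂, rfl⟩,
      Algebra.discr_sub_discr_mem hJ e b₁ b₂ (fun i => (he i).symm) hb₂⟩
  -- Only the basis transfer is reversed; the one inclusion `hJ` serves both directions.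
  · obtain ⟨m, b₂, rfl⟩ := isDiscriminant_algebraMap_iff.mp hD'
    choose e he using fun i => Ideal.Quotient.mk_surjective (b₂ i)
    obtain ⟨b₁, hb₁⟩ := b₂.exists_quotient_basis_of_sup_eq h₂₁ h₁₂ e fun i => (he i).symm
    exact ⟨_, isDiscriminant_algebraMap_iff.mpr ⟨m, b₁, rfl⟩,
      Algebra.discr_sub_discr_mem hJ e b₁ b₂ hb₁ fun i => (he i).symm⟩

end Main

theorem mainTheorem7 {k R : Type*} [Field k] [CommRing R] [IsLocalRing R]
    [IsCohenMacaulayLocal R] [IsAdicComplete (IsLocalRing.maximalIdeal R) R]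
    [Algebra k R] (hk : IsCoefficientField k R) {c s : ℕ} (f : Fin c → R) (x : Fin s → R)
    (hfx : IsSystemOfParameters (Fin.append f x)) :
    IsFiniteFree (paramMap k f x hfx.mem_right) ∧
    ∃ C : ℕ, ∀ n : ℕ, 1 ≤ n → ∀ ε : Fin c → R,
      (∀ i, ε i ∈ IsLocalRing.maximalIdeal R ^ (C * n)) →
      IsSystemOfParameters (Fin.append (f + ε) x) ∧
      IsFiniteFree (paramMap k (f + ε) x hfx.mem_right) ∧
      (∀ D, IsDiscriminant (paramMap k f x hfx.mem_right) D →
        ∃ D', IsDiscriminant (paramMap k (f + ε) x hfx.mem_right) D' ∧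
          D - D' ∈ IsLocalRing.maximalIdeal (MvPowerSeries (Fin s) k) ^ n) ∧
      (∀ D', IsDiscriminant (paramMap k (f + ε) x hfx.mem_right) D' →
        ∃ D, IsDiscriminant (paramMap k f x hfx.mem_right) D ∧
          D - D' ∈ IsLocalRing.maximalIdeal (MvPowerSeries (Fin s) k) ^ n) := by
  have : IsNoetherianRing R := IsCohenMacaulayLocal.noetherian
  -- With this structure, `paramMap` is definitionally the algebra map to the quotient.
  let : Algebra (MvPowerSeries (Fin s) k) R :=
    (powerSeriesEval k x hfx.mem_right).toRingHom.toAlgebra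
  have hX : (fun i => algebraMap (MvPowerSeries (Fin s) k) R (MvPowerSeries.X i)) = x :=
    funext (powerSeriesEval_X k x hfx.mem_right)
  have hmax := MvPowerSeries.span_range_X_eq_maximalIdeal (Fin s) k
  have hcomplete : IsAdicComplete (maximalIdeal (MvPowerSeries (Fin s) k))
      (MvPowerSeries (Fin s) k) := hmax ▸ inferInstance
  have hres : Function.Surjective
      ((residue R).comp (algebraMap (MvPowerSeries (Fin s) k) R)) := fun r => by
    obtain ⟨a, rfl⟩ := hk.2 r
    exact ⟨algebraMap k _ a,
      congrArg (residue R) ((powerSeriesEval k x hfx.mem_right).commutes a)⟩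
  have hff (g : Fin c → R) (hg : IsSystemOfParameters (Fin.append g x)) :
      IsFiniteFree (paramMap k g x hfx.mem_right) :=
    isFiniteFree_algebraMap_iff.mpr
      (IsSystemOfParameters.finite_free_quotient MvPowerSeries.X hmax hres (by rwa [hX]))
  obtain ⟨C, hC⟩ := exists_forall_isDiscriminant_congruent (f := f) MvPowerSeries.X hmax hres
    (by rwa [hX])
  refine ⟨hff f hfx, C, fun n hn ε hε => ?_⟩
  obtain ⟨hsop, hD⟩ := hC n hn ε hε
  rw [hX] at hsop
  exact ⟨hsop, hff _ hsop, hD⟩
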